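/- A permutation $\sigma=\sigma_1\cdots\sigma_n$ of $[n]=\{1,\dots,n\}$ contains $\eta=\eta_1\eta_2\eta_3\in S_3$ as a pattern if there are $1\le i_1<i_2<i_3\le n$ such that for all $j,k\in\{1,2,3\}$ one has $\sigma_{i_j}<\sigma_{i_k}$ if and only if $\eta_j<\eta_k$; otherwise $\sigma$ avoids $\eta$. Let $P_n^{\mathrm{av}(\eta)}$ be the uniform probability measure on the set of permutations of $[n]$ that avoid $\eta$, and let $L_n(\sigma)$ be the length of the longest increasing subsequence of $\sigma$, that is, the largest $k$ for which there are $i_1<\cdots<i_k$ with $\sigma_{i_1}<\cdots<\sigma_{i_k}$. **Theorem.** Let $\eta\in\{231,312\}$. Then $$\lim_{n\to\infty}\frac1n\log P_n^{\mathrm{av}(\eta)}(L_n\ge nx)=-I^{\mathrm{inc}}(x)\quad\text{for every } x\in[\tfrac12,1],$$ $$\lim_{n\to\infty}\frac1n\log P_n^{\mathrm{av}(\eta)}(L_n\le nx)=-I^{\mathrm{inc}}(x)\quad\text{for every } x\in(0,\tfrac12],$$ where in each case the probability is positive for all sufficiently large $n$, and where $$I^{\mathrm{inc}}(x)=2\big(x\log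 x+(1-x)\log(1-x)+\log 2\big)\ \text{ for } x\in(0,1),\qquad I^{\mathrm{inc}}(1)=\log 4.$$ -/

import Mathlib

open Filter Topology ProbabilityTheory MeasureTheory

namespace PatternAvoidance

/-- The set `S_n` of permutations of `n` letters, as a discrete measurable space. -/
instance instMeasurableSpacePermFin (n : ℕ) : MeasurableSpace (Equiv.Perm (Fin n)) := ⊤

instance instDiscreteMeasurableSpacePermFin (n : ℕ) :
    DiscreteMeasurableSpace (Equiv.Perm (Fin n)) := ⟨fun _ => trivial⟩

/-- `σ` contains `η` as a pattern: there are positions `i₁ < ⋯ < iₘ` at which the values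
of `σ` are in the same relative order as `η₁, …, ηₘ`. -/
def Contains {m n : ℕ} (η : Equiv.Perm (Fin m)) (σ : Equiv.Perm (Fin n)) : Prop :=
  ∃ i : Fin m → Fin n, StrictMono i ∧ ∀ j k : Fin m, σ (i j) < σ (i k) ↔ η j < η k

/-- The set `S_n^{av(η)}` of permutations in `S_n` that avoid `η`. -/
def avoiding {m : ℕ} (η : Equiv.Perm (Fin m)) (n : ℕ) : Set (Equiv.Perm (Fin n)) :=
  {σ | ¬ Contains η σ}

/-- The uniform probability measure `P_n^{av(η)}` on `S_n^{av(η)}`, as a measure on `S_n`. -/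
noncomputable def avoidMeasure {m : ℕ} (η : Equiv.Perm (Fin m)) (n : ℕ) :
    Measure (Equiv.Perm (Fin n)) :=
  uniformOn (avoiding η n)

open Classical in
/-- The length `L_n(σ)` of the longest increasing subsequence of `σ`: the largest size of a set
of positions on which `σ` is increasing. -/
noncomputable def longestIncreasing {n : ℕ} (σ : Equiv.Perm (Fin n)) : ℕ :=
  (Finset.univ.filter fun s : Finset (Fin n) => StrictMonoOn σ (s : Set (Fin n))).sup Finset.card

/-- The permutation 231 in one-line notation (letters shifted to `0, 1, 2`). -/
def perm231 : Equiv.Perm (Fin 3) where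
  toFun := ![1, 2, 0]
  invFun := ![2, 0, 1]
  left_inv := by decide
  right_inv := by decide

/-- The permutation 312 in one-line notation (letters shifted to `0, 1, 2`). -/
def perm312 : Equiv.Perm (Fin 3) where
  toFun := ![2, 0, 1]
  invFun := ![1, 2, 0]
  left_inv := by decide
  right_inv := by decide

/-- The rate function: `2 (x log x + (1 - x) log (1 - x) + log 2)` on `(0,1)`,
with the value `log 4` at `x = 1`. -/
noncomputable def rateInc (x : ℝ) : ℝ :=
  if x = 1 then Real.log 4
  else 2 * (x * Real.log x + (1 - x) * Real.log (1 - x) + Real.log 2)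

end PatternAvoidance

namespace PatternAvoidance

/-! A 231-avoiding permutation splits at its maximum as `L n R` with every letter of `L` below every
letter of `R`, and the longest increasing length is that of `L` plus `max 1` of that of `R`
(`longestIncreasing_glue`, `exists_glue_eq`). Hence the bivariate generating function satisfies F =
z(1 + F)(X + F) (`lisSeries_eq`). The coefficients of all powers of F then obey a linear recursion,
solved by a reflected product of binomials; the first power gives the Narayana numbers
(`lisCount_succ_succ`).

The number of avoiders of n + 1 letters with length k + 1 is therefore C(n,k)² up to a factor n + 1.
By Stirling, (1/n) log C(n,k)² tends to 2H(x) when k/n → x, with H the binary entropy. A sum over at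
most n lengths has the exponential rate of its largest term, which for both tails is the admissible
length nearest n/2; the total grows at rate 2 log 2. Subtracting gives `-rateInc x`. Inversion
carries 231 to 312 and preserves increasing length. -/

/-! ### Patterns, increasing subsequences and inversion. -/

theorem contains_perm231_iff {n : ℕ} (σ : Equiv.Perm (Fin n)) :
    Contains perm231 σ ↔ ∃ a b c : Fin n, a < b ∧ b < c ∧ σ c < σ a ∧ σ a < σ b := by
  constructor
  · rintro ⟨i, hi, h⟩
    exact ⟨i 0, i 1, i 2, hi (by decide), hi (by decide), (h 2 0).2 (by decide),
      (h 0 1).2 (by decide)⟩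
  · rintro ⟨a, b, c, hab, hbc, h1, h2⟩
    refine ⟨![a, b, c], ?_, ?_⟩
    · intro j k hjk
      fin_cases j <;> fin_cases k <;> simp_all
      exact hab.trans hbc
    · intro j k
      have h3 := h1.trans h2
      fin_cases j <;> fin_cases k <;> simp [perm231, h1, h2, h3, h1.le, h2.le, h3.le]

theorem contains_perm312_iff {n : ℕ} (σ : Equiv.Perm (Fin n)) :
    Contains perm312 σ ↔ ∃ a b c : Fin n, a < b ∧ b < c ∧ σ b < σ c ∧ σ c < σ a := by
  constructor
  · rintro ⟨i, hi, h⟩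
    exact ⟨i 0, i 1, i 2, hi (by decide), hi (by decide), (h 1 2).2 (by decide),
      (h 2 0).2 (by decide)⟩
  · rintro ⟨a, b, c, hab, hbc, h1, h2⟩
    refine ⟨![a, b, c], ?_, ?_⟩
    · intro j k hjk
      fin_cases j <;> fin_cases k <;> simp_all
      exact hab.trans hbc
    · intro j k
      have h3 := h1.trans h2
      fin_cases j <;> fin_cases k <;> simp [perm312, h1, h2, h3, h1.le, h2.le, h3.le]

/-- Inversion exchanges positions with values, and 312 is the inverse of 231. -/
theorem contains_perm312_iff_inv {n : ℕ} (σ : Equiv.Perm (Fin n)) :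
    Contains perm312 σ ↔ Contains perm231 σ⁻¹ := by
  rw [contains_perm312_iff, contains_perm231_iff]
  constructor
  · rintro ⟨a, b, c, hab, hbc, h1, h2⟩
    exact ⟨σ b, σ c, σ a, h1, h2, by simpa using hab, by simpa using hbc⟩
  · rintro ⟨a, b, c, hab, hbc, h1, h2⟩
    exact ⟨σ⁻¹ c, σ⁻¹ a, σ⁻¹ b, h1, h2, by simpa using hab, by simpa using hbc⟩

theorem card_le_longestIncreasing {n : ℕ} {σ : Equiv.Perm (Fin n)} {s : Finset (Fin n)}
    (hs : StrictMonoOn σ (s : Set (Fin n))) : s.card ≤ longestIncreasing σ := by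
  classical
  unfold longestIncreasing
  exact Finset.le_sup (f := Finset.card) (by simpa using hs)

theorem longestIncreasing_le {n : ℕ} {σ : Equiv.Perm (Fin n)} {k : ℕ}
    (h : ∀ s : Finset (Fin n), StrictMonoOn σ (s : Set (Fin n)) → s.card ≤ k) :
    longestIncreasing σ ≤ k := by
  classical
  unfold longestIncreasing
  exact Finset.sup_le fun s hs => h s (by simpa using hs)

theorem exists_card_eq_longestIncreasing {n : ℕ} (σ : Equiv.Perm (Fin n)) :
    ∃ s : Finset (Fin n), StrictMonoOn σ (s : Set (Fin n)) ∧ s.card = longestIncreasing σ := by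
  classical
  unfold longestIncreasing
  obtain ⟨s, hs, h⟩ := Finset.exists_mem_eq_sup
    (Finset.univ.filter fun s : Finset (Fin n) => StrictMonoOn σ (s : Set (Fin n)))
    ⟨∅, by simp [StrictMonoOn]⟩ Finset.card
  exact ⟨s, by simpa using hs, h.symm⟩

theorem longestIncreasing_le_self {n : ℕ} (σ : Equiv.Perm (Fin n)) : longestIncreasing σ ≤ n :=
  longestIncreasing_le fun s _ => by simpa using s.card_le_univ

theorem one_le_longestIncreasing {n : ℕ} (σ : Equiv.Perm (Fin (n + 1))) :
    1 ≤ longestIncreasing σ :=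
  card_le_longestIncreasing (s := {0}) (by simp)

theorem longestIncreasing_le_inv {n : ℕ} (σ : Equiv.Perm (Fin n)) :
    longestIncreasing σ ≤ longestIncreasing σ⁻¹ := by
  refine longestIncreasing_le fun s hs => ?_
  rw [← Finset.card_map σ.toEmbedding]
  refine card_le_longestIncreasing ?_
  intro a ha b hb hab
  simp only [Finset.coe_map, Set.mem_image] at ha hb
  obtain ⟨a, ha, rfl⟩ := ha
  obtain ⟨b, hb, rfl⟩ := hb
  simpa using (hs.lt_iff_lt ha hb).1 hab

theorem longestIncreasing_inv {n : ℕ} (σ : Equiv.Perm (Fin n)) :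
    longestIncreasing σ⁻¹ = longestIncreasing σ :=
  le_antisymm (by simpa using longestIncreasing_le_inv σ⁻¹) (longestIncreasing_le_inv σ)

/-! ### Decomposition at the maximum. -/

section Glue

variable {i j : ℕ}

/-- The `a`-th of the positions to the left of position `i`. -/
def leftPos (j : ℕ) (a : Fin i) : Fin (i + j + 1) := ⟨a, by omega⟩

/-- The position `i`. -/
def midPos (i j : ℕ) : Fin (i + j + 1) := ⟨i, by omega⟩

/-- The `b`-th of the positions to the right of position `i`. -/
def rightPos (i : ℕ) (b : Fin j) : Fin (i + j + 1) := ⟨i + 1 + b, by omega⟩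

theorem pos_cases (p : Fin (i + j + 1)) :
    (∃ a : Fin i, p = leftPos j a) ∨ p = midPos i j ∨ ∃ b : Fin j, p = rightPos i b := by
  rcases lt_trichotomy (p : ℕ) i with h | h | h
  · exact Or.inl ⟨⟨p, h⟩, rfl⟩
  · exact Or.inr (Or.inl (Fin.ext h))
  · exact Or.inr (Or.inr ⟨⟨p - (i + 1), by omega⟩, Fin.ext (by simp [rightPos]; omega)⟩)

/-- The one-line word `L n R`, where the word `R` is shifted above `L`. -/
def glueFun (L : Equiv.Perm (Fin i)) (R : Equiv.Perm (Fin j)) (p : Fin (i + j + 1)) :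
    Fin (i + j + 1) :=
  if h : (p : ℕ) < i then ⟨L ⟨p, h⟩, by omega⟩
  else if h' : (p : ℕ) = i then Fin.last (i + j)
  else ⟨i + R ⟨p - (i + 1), by omega⟩, by omega⟩

theorem glueFun_leftPos (L : Equiv.Perm (Fin i)) (R : Equiv.Perm (Fin j)) (a : Fin i) :
    (glueFun L R (leftPos j a) : ℕ) = L a := by
  simp [glueFun, leftPos]

theorem glueFun_midPos (L : Equiv.Perm (Fin i)) (R : Equiv.Perm (Fin j)) :
    (glueFun L R (midPos i j) : ℕ) = i + j := by
  simp [glueFun, midPos]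

theorem glueFun_rightPos (L : Equiv.Perm (Fin i)) (R : Equiv.Perm (Fin j)) (b : Fin j) :
    (glueFun L R (rightPos i b) : ℕ) = i + R b := by
  have h1 : ¬ (i + 1 + (b : ℕ) < i) := by omega
  have h2 : ¬ (i + 1 + (b : ℕ) = i) := by omega
  simp [glueFun, rightPos, h1, h2]

theorem glueFun_injective (L : Equiv.Perm (Fin i)) (R : Equiv.Perm (Fin j)) :
    Function.Injective (glueFun L R) := by
  intro p q h
  have h := congrArg Fin.val h
  rcases pos_cases p with ⟨a, rfl⟩ | rfl | ⟨a, rfl⟩ <;>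
  rcases pos_cases q with ⟨b, rfl⟩ | rfl | ⟨b, rfl⟩ <;>
  simp only [glueFun_leftPos, glueFun_midPos, glueFun_rightPos] at h
  · rw [L.injective (Fin.ext h)]
  · have := (L a).isLt; omega
  · have := (L a).isLt; omega
  · have := (L b).isLt; omega
  · rfl
  · have := (R b).isLt; omega
  · have := (L b).isLt; omega
  · have := (R a).isLt; omega
  · rw [R.injective (Fin.ext (Nat.add_left_cancel h))]

/-- The permutation with one-line word `L n R`, where the word `R` is shifted above `L`. -/
noncomputable def glue (L : Equiv.Perm (Fin i)) (R : Equiv.Perm (Fin j)) :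
    Equiv.Perm (Fin (i + j + 1)) :=
  Equiv.ofBijective (glueFun L R) (Finite.injective_iff_bijective.1 (glueFun_injective L R))

variable (L : Equiv.Perm (Fin i)) (R : Equiv.Perm (Fin j))

theorem glue_leftPos (a : Fin i) : (glue L R (leftPos j a) : ℕ) = L a := glueFun_leftPos L R a

theorem glue_midPos : (glue L R (midPos i j) : ℕ) = i + j := glueFun_midPos L R

theorem glue_rightPos (b : Fin j) : (glue L R (rightPos i b) : ℕ) = i + R b :=
  glueFun_rightPos L R b

theorem rightPos_lt_iff {a b : Fin j} : rightPos i a < rightPos i b ↔ a < b := by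
  rw [Fin.lt_def, Fin.lt_def]
  exact Nat.add_lt_add_iff_left

theorem glue_rightPos_lt_iff {a b : Fin j} :
    glue L R (rightPos i a) < glue L R (rightPos i b) ↔ R a < R b := by
  rw [Fin.lt_def, Fin.lt_def, glue_rightPos, glue_rightPos]
  exact Nat.add_lt_add_iff_left

/-- The last letter of a 231 is its smallest. If the first lies in the left block, the last must
too; the maximum cannot come first; otherwise all three lie in the right block. -/
theorem contains_glue_iff :
    Contains perm231 (glue L R) ↔ Contains perm231 L ∨ Contains perm231 R := by
  simp only [contains_perm231_iff]
  constructor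
  · rintro ⟨p, q, r, hpq, hqr, h1, h2⟩
    simp only [Fin.lt_def] at hpq hqr h1 h2
    rcases pos_cases p with ⟨a, rfl⟩ | rfl | ⟨a, rfl⟩ <;>
    rcases pos_cases q with ⟨b, rfl⟩ | rfl | ⟨b, rfl⟩ <;>
    rcases pos_cases r with ⟨c, rfl⟩ | rfl | ⟨c, rfl⟩ <;>
    simp only [glue_leftPos, glue_midPos, glue_rightPos] at h1 h2 <;>
    simp only [leftPos, midPos, rightPos] at hpq hqr
    case inl.inl.inl =>
      exact Or.inl ⟨a, b, c, hpq, hqr, h1, h2⟩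
    case inr.inr.inr.inr.inr.inr =>
      exact Or.inr ⟨a, b, c, Fin.lt_def.2 (by omega), Fin.lt_def.2 (by omega),
        Fin.lt_def.2 (by omega), Fin.lt_def.2 (by omega)⟩
    all_goals omega
  · rintro (⟨a, b, c, hab, hbc, h1, h2⟩ | ⟨a, b, c, hab, hbc, h1, h2⟩)
    · exact ⟨leftPos j a, leftPos j b, leftPos j c, hab, hbc,
        by simpa only [Fin.lt_def, glue_leftPos] using h1,
        by simpa only [Fin.lt_def, glue_leftPos] using h2⟩
    · exact ⟨rightPos i a, rightPos i b, rightPos i c,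
        rightPos_lt_iff.2 hab, rightPos_lt_iff.2 hbc,
        (glue_rightPos_lt_iff L R).2 h1, (glue_rightPos_lt_iff L R).2 h2⟩

theorem leftPos_injective : Function.Injective (leftPos j : Fin i → _) := fun a b h => by
  simpa [leftPos, Fin.ext_iff] using h

theorem rightPos_injective : Function.Injective (rightPos i : Fin j → _) := fun a b h => by
  simpa [rightPos, Fin.ext_iff] using h

/-- An increasing subsequence through the maximum ends there; one that misses it is a subsequence of
`L` followed by one of `R`. The `max 1` matters only when `R` is empty. -/
theorem longestIncreasing_glue :
    longestIncreasing (glue L R) = longestIncreasing L + max 1 (longestIncreasing R) := by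
  classical
  apply le_antisymm
  · refine longestIncreasing_le fun s hs => ?_
    set sl : Finset (Fin i) := Finset.univ.filter fun a => leftPos j a ∈ s with hsl
    set sr : Finset (Fin j) := Finset.univ.filter fun b => rightPos i b ∈ s with hsr
    have hl : sl.card ≤ longestIncreasing L := by
      refine card_le_longestIncreasing fun a ha b hb hab => ?_
      have := hs (a := leftPos j a) (by simpa [hsl] using ha) (b := leftPos j b)
        (by simpa [hsl] using hb) hab
      simpa only [Fin.lt_def, glue_leftPos] using this
    have hr : sr.card ≤ longestIncreasing R := by
      refine card_le_longestIncreasing fun a ha b hb hab => ?_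
      exact (glue_rightPos_lt_iff L R).1 (hs (a := rightPos i a) (by simpa [hsr] using ha)
        (b := rightPos i b) (by simpa [hsr] using hb) (rightPos_lt_iff.2 hab))
    by_cases hm : midPos i j ∈ s
    · have hsub : s ⊆ insert (midPos i j) (sl.image (leftPos j)) := by
        intro p hp
        rcases pos_cases p with ⟨a, rfl⟩ | rfl | ⟨b, rfl⟩
        · exact Finset.mem_insert_of_mem (Finset.mem_image_of_mem _ (by simpa [hsl] using hp))
        · simp
        · have := hs hm hp (by simp [Fin.lt_def, midPos, rightPos]; omega)
          rw [Fin.lt_def, glue_midPos] at this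
          omega
      have h1 := Finset.card_le_card hsub
      have h2 := Finset.card_insert_le (midPos i j) (sl.image (leftPos j))
      have h3 := Finset.card_image_le (s := sl) (f := leftPos j)
      omega
    · have hsub : s ⊆ sl.image (leftPos j) ∪ sr.image (rightPos i) := by
        intro p hp
        rcases pos_cases p with ⟨a, rfl⟩ | rfl | ⟨b, rfl⟩
        · exact Finset.mem_union_left _ (Finset.mem_image_of_mem _ (by simpa [hsl] using hp))
        · exact absurd hp hm
        · exact Finset.mem_union_right _ (Finset.mem_image_of_mem _ (by simpa [hsr] using hp))
      have h1 := Finset.card_le_card hsub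
      have h2 := Finset.card_union_le (sl.image (leftPos j)) (sr.image (rightPos i))
      have h3 := Finset.card_image_le (s := sl) (f := leftPos j)
      have h4 := Finset.card_image_le (s := sr) (f := rightPos i)
      omega
  · obtain ⟨sl, hl, hlc⟩ := exists_card_eq_longestIncreasing L
    obtain ⟨sr, hr, hrc⟩ := exists_card_eq_longestIncreasing R
    rw [← Nat.add_max_add_left]
    apply max_le
    · have hd : midPos i j ∉ sl.image (leftPos j) := by
        simp only [Finset.mem_image, not_exists, not_and]
        intro a _ h
        have := congrArg Fin.val h
        simp only [leftPos, midPos] at this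
        omega
      rw [← hlc, ← Finset.card_image_of_injective sl leftPos_injective (β := Fin (i + j + 1)),
        ← Finset.card_insert_of_notMem hd]
      refine card_le_longestIncreasing fun p hp q hq hpq => ?_
      simp only [Finset.coe_insert, Finset.coe_image, Set.mem_insert_iff, Set.mem_image] at hp hq
      rw [Fin.lt_def] at hpq ⊢
      rcases hp with rfl | ⟨a, ha, rfl⟩ <;> rcases hq with rfl | ⟨b, hb, rfl⟩ <;>
        simp only [glue_leftPos, glue_midPos] <;> simp only [leftPos, midPos] at hpq
      · omega
      · omega
      · omega
      · exact hl ha hb hpq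
    · have hd : Disjoint (sl.image (leftPos j)) (sr.image (rightPos i)) := by
        rw [Finset.disjoint_left]
        simp only [Finset.mem_image, not_exists, not_and]
        rintro _ ⟨a, _, rfl⟩ b _ h
        have := congrArg Fin.val h
        simp only [leftPos, rightPos] at this
        omega
      rw [← hlc, ← hrc,
        ← Finset.card_image_of_injective sl leftPos_injective (β := Fin (i + j + 1)),
        ← Finset.card_image_of_injective sr rightPos_injective (β := Fin (i + j + 1)),
        ← Finset.card_union_of_disjoint hd]
      refine card_le_longestIncreasing fun p hp q hq hpq => ?_
      simp only [Finset.coe_union, Finset.coe_image, Set.mem_union, Set.mem_image] at hp hq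
      rw [Fin.lt_def] at hpq ⊢
      rcases hp with ⟨a, ha, rfl⟩ | ⟨a, ha, rfl⟩ <;> rcases hq with ⟨b, hb, rfl⟩ | ⟨b, hb, rfl⟩ <;>
        simp only [glue_leftPos, glue_rightPos] <;> simp only [leftPos, rightPos] at hpq
      · exact hl ha hb hpq
      · omega
      · omega
      · have := hr ha hb (by rw [Fin.lt_def]; omega)
        rw [Fin.lt_def] at this
        omega

theorem glue_injective :
    Function.Injective fun x : Equiv.Perm (Fin i) × Equiv.Perm (Fin j) => glue x.1 x.2 := by
  rintro ⟨L, R⟩ ⟨L', R'⟩ h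
  simp only at h
  refine Prod.ext (Equiv.ext fun a => Fin.ext ?_) (Equiv.ext fun b => Fin.ext ?_)
  · simpa only [glue_leftPos] using congrArg (fun τ => (τ (leftPos j a) : ℕ)) h
  · simpa [glue_rightPos] using congrArg (fun τ => (τ (rightPos i b) : ℕ)) h

/-- A left letter above a right letter would form a 231 with the maximum between them. So left lies
below right, and counting shows that the left block takes exactly the values below `i`. -/
theorem exists_glue_eq {σ : Equiv.Perm (Fin (i + j + 1))} (hσ : ¬ Contains perm231 σ)
    (hm : σ (midPos i j) = Fin.last (i + j)) : ∃ L R, glue (i := i) (j := j) L R = σ := by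
  classical
  have hne : ∀ p, p ≠ midPos i j → (σ p : ℕ) < i + j := by
    intro p hp
    have h : σ p ≠ Fin.last (i + j) := fun h => hp (σ.injective (h.trans hm.symm))
    have := Fin.val_ne_of_ne h
    simp only [Fin.val_last] at this
    omega
  have hL : ∀ a : Fin i, leftPos j a ≠ midPos i j := fun a h => by
    simp [leftPos, midPos, Fin.ext_iff] at h; omega
  have hR : ∀ b : Fin j, rightPos i b ≠ midPos i j := fun b h => by
    simp [rightPos, midPos, Fin.ext_iff] at h; omega
  have key : ∀ (a : Fin i) (b : Fin j), (σ (leftPos j a) : ℕ) < σ (rightPos i b) := by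
    intro a b
    by_contra hlt
    rw [contains_perm231_iff] at hσ
    have hab : leftPos j a ≠ rightPos i b := fun h => by
      simp [leftPos, rightPos, Fin.ext_iff] at h; omega
    have := Fin.val_ne_of_ne (σ.injective.ne hab)
    refine hσ ⟨leftPos j a, midPos i j, rightPos i b, by simp [leftPos, midPos, Fin.lt_def],
      by simp [rightPos, midPos, Fin.lt_def]; omega, by rw [Fin.lt_def]; omega, ?_⟩
    rw [hm, Fin.lt_def]
    exact hne _ (hL a)
  have hlow : ∀ a : Fin i, (σ (leftPos j a) : ℕ) < i := by
    intro a
    by_contra hge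
    -- The `j` right letters would fit strictly between a value at least `i` and the maximum `i +
    -- j`, where fewer than `j` values exist.
    have hc := Finset.card_le_card_of_injOn (s := (Finset.univ : Finset (Fin j)))
      (t := Finset.Ioo (σ (leftPos j a) : ℕ) (i + j)) (fun b => (σ (rightPos i b) : ℕ))
      (fun b _ => by simpa using ⟨key a b, hne _ (hR b)⟩)
      (fun b _ b' _ h => rightPos_injective (σ.injective (Fin.ext h)))
    have := hne _ (hL a)
    simp only [Finset.card_univ, Fintype.card_fin, Nat.card_Ioo] at hc
    omega
  have hhigh : ∀ b : Fin j, i ≤ (σ (rightPos i b) : ℕ) := by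
    intro b
    have hc := Finset.card_le_card_of_injOn (s := (Finset.univ : Finset (Fin i)))
      (t := Finset.range (σ (rightPos i b) : ℕ)) (fun a => (σ (leftPos j a) : ℕ))
      (fun a _ => by simpa using key a b)
      (fun b _ b' _ h => leftPos_injective (σ.injective (Fin.ext h)))
    simpa using hc
  let fL : Fin i → Fin i := fun a => ⟨σ (leftPos j a), hlow a⟩
  let fR : Fin j → Fin j := fun b => ⟨σ (rightPos i b) - i, by
    have := hhigh b
    have := hne _ (hR b)
    omega⟩
  have hfL : Function.Injective fL := fun a a' h =>
    leftPos_injective (σ.injective (Fin.ext (by simpa [fL] using h)))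
  have hfR : Function.Injective fR := fun b b' h => by
    have h1 := hhigh b
    have h2 := hhigh b'
    have h3 : (σ (rightPos i b) : ℕ) - i = σ (rightPos i b') - i := by
      simpa [fR] using h
    exact rightPos_injective (σ.injective (Fin.ext (by omega)))
  refine ⟨Equiv.ofBijective fL (Finite.injective_iff_bijective.1 hfL),
    Equiv.ofBijective fR (Finite.injective_iff_bijective.1 hfR), Equiv.ext fun p => Fin.ext ?_⟩
  rcases pos_cases p with ⟨a, rfl⟩ | rfl | ⟨b, rfl⟩
  · simp [glue_leftPos, fL]
  · simp [glue_midPos, hm]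
  · have := hhigh b
    simp [glue_rightPos, fR]
    omega

end Glue

/-! ### Generating polynomials and their recursion. -/

open Classical in
/-- The permutations of `n` letters that avoid 231. -/
noncomputable def avoiders231 (n : ℕ) : Finset (Equiv.Perm (Fin n)) :=
  Finset.univ.filter fun σ => ¬ Contains perm231 σ

theorem mem_avoiders231 {n : ℕ} {σ : Equiv.Perm (Fin n)} :
    σ ∈ avoiders231 n ↔ ¬ Contains perm231 σ := by
  simp [avoiders231]

open Polynomial

/-- The generating polynomial of the length of the longest increasing subsequence over the
231-avoiding permutations of `n` letters. -/
noncomputable def lisPoly (n : ℕ) : ℤ[X] :=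
  ∑ σ ∈ avoiders231 n, X ^ longestIncreasing σ

/-- The number of 231-avoiding permutations of `n` letters with longest increasing subsequence
of length `k`. -/
noncomputable def lisCount (n k : ℕ) : ℕ :=
  ((avoiders231 n).filter fun σ => longestIncreasing σ = k).card

theorem coeff_lisPoly (n k : ℕ) : (lisPoly n).coeff k = lisCount n k := by
  simp [lisPoly, lisCount, Polynomial.finsetSum_coeff, Polynomial.coeff_X_pow, eq_comm]

theorem avoiders231_zero : avoiders231 0 = {1} := by
  ext σ
  simp only [mem_avoiders231, contains_perm231_iff, IsEmpty.exists_iff, not_false_eq_true,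
    Finset.mem_singleton, true_iff]
  exact Subsingleton.elim _ _

theorem longestIncreasing_fin_zero (σ : Equiv.Perm (Fin 0)) : longestIncreasing σ = 0 :=
  Nat.le_zero.1 (longestIncreasing_le_self σ)

theorem lisPoly_zero : lisPoly 0 = 1 := by
  simp [lisPoly, avoiders231_zero, longestIncreasing_fin_zero]

/-- The generating polynomial of the contribution of the word at and to the right of the
maximum. -/
noncomputable def rightPoly (n : ℕ) : ℤ[X] := if n = 0 then X else lisPoly n

/-- The exceptional value `X` at 0 is the maximum counted alone when nothing follows it. -/
theorem rightPoly_eq_sum (n : ℕ) :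
    rightPoly n = ∑ σ ∈ avoiders231 n, X ^ max 1 (longestIncreasing σ) := by
  cases n with
  | zero =>
    simp [rightPoly, avoiders231_zero, longestIncreasing_fin_zero]
  | succ n =>
    simp only [rightPoly, Nat.succ_ne_zero, if_false, lisPoly]
    exact Finset.sum_congr rfl fun σ _ => by rw [max_eq_right (one_le_longestIncreasing σ)]

theorem sum_avoiders231_max_at (i j : ℕ) :
    ∑ σ ∈ (avoiders231 (i + j + 1)).filter fun σ => σ (midPos i j) = Fin.last (i + j),
      (X : ℤ[X]) ^ longestIncreasing σ = lisPoly i * rightPoly j := by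
  rw [rightPoly_eq_sum, lisPoly, Finset.sum_mul_sum, ← Finset.sum_product']
  symm
  refine Finset.sum_bij (fun x _ => glue x.1 x.2) ?_ (fun x _ y _ h => glue_injective h) ?_ ?_
  · rintro ⟨L, R⟩ h
    simp only [Finset.mem_product, mem_avoiders231] at h
    simp only [Finset.mem_filter, mem_avoiders231, contains_glue_iff]
    exact ⟨by tauto, Fin.ext (glue_midPos L R)⟩
  · intro σ hσ
    simp only [Finset.mem_filter, mem_avoiders231] at hσ
    obtain ⟨L, R, rfl⟩ := exists_glue_eq hσ.1 hσ.2
    rw [contains_glue_iff] at hσ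
    exact ⟨(L, R), by simp only [Finset.mem_product, mem_avoiders231]; tauto, rfl⟩
  · rintro ⟨L, R⟩ _
    simp only [longestIncreasing_glue, pow_add]

theorem lisPoly_succ (n : ℕ) :
    lisPoly (n + 1) = ∑ p ∈ Finset.HasAntidiagonal.antidiagonal n, lisPoly p.1 * rightPoly p.2 := by
  rw [Finset.Nat.sum_antidiagonal_eq_sum_range_succ (fun i j => lisPoly i * rightPoly j),
    Finset.sum_range, lisPoly,
    ← Finset.sum_fiberwise _ (fun σ : Equiv.Perm (Fin (n + 1)) => σ.symm (Fin.last n))]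
  refine Finset.sum_congr rfl fun k _ => ?_
  obtain ⟨i, hi⟩ := k
  obtain ⟨j, rfl⟩ := Nat.exists_eq_add_of_le (Nat.le_of_lt_succ hi)
  simp only [Nat.add_sub_cancel_left]
  rw [← sum_avoiders231_max_at]
  refine Finset.sum_congr (Finset.filter_congr fun σ _ => ?_) fun _ _ => rfl
  rw [Equiv.symm_apply_eq]
  exact eq_comm

/-! ### The functional equation and the Narayana numbers. -/

/-- The bivariate generating function of nonempty 231-avoiding permutations. -/
noncomputable def lisSeries : PowerSeries ℤ[X] :=
  PowerSeries.mk fun n => if n = 0 then 0 else lisPoly n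

/-- The outer `X` of the power series ring marks the maximum. An empty left block weighs 1, an empty
right block weighs the polynomial variable. -/
theorem lisSeries_eq :
    lisSeries = PowerSeries.X * ((1 + lisSeries) * (PowerSeries.C X + lisSeries)) := by
  ext1 n
  cases n with
  | zero => simp [lisSeries]
  | succ n =>
    rw [PowerSeries.coeff_succ_X_mul, PowerSeries.coeff_mul]
    simp only [lisSeries, PowerSeries.coeff_mk, Nat.succ_ne_zero, if_false, lisPoly_succ]
    refine Finset.sum_congr rfl fun p _ => ?_
    congr 1
    · rw [map_add, PowerSeries.coeff_one, PowerSeries.coeff_mk]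
      split_ifs with h
      · simp [h, lisPoly_zero]
      · simp
    · rw [map_add, PowerSeries.coeff_C, PowerSeries.coeff_mk, rightPoly]
      split_ifs <;> simp

/-- Expanding a single factor by the quadratic functional equation yields a recursion that is
linear, at the price of treating all powers together. -/
theorem coeff_lisSeries_pow (m n : ℕ) :
    PowerSeries.coeff (n + 1) (lisSeries ^ (m + 1)) =
      X * PowerSeries.coeff n (lisSeries ^ m) + PowerSeries.coeff n (lisSeries ^ (m + 1))
      + X * PowerSeries.coeff n (lisSeries ^ (m + 1)) + PowerSeries.coeff n (lisSeries ^ (m + 2)) := by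
  have h : lisSeries ^ (m + 1) = PowerSeries.X * (PowerSeries.C X * lisSeries ^ m
      + lisSeries ^ (m + 1) + PowerSeries.C X * lisSeries ^ (m + 1) + lisSeries ^ (m + 2)) := by
    conv_lhs => rw [pow_succ]
    nth_rw 2 [lisSeries_eq]
    ring
  rw [h, PowerSeries.coeff_succ_X_mul, ← h]
  simp only [map_add, PowerSeries.coeff_C_mul]

/-- The binomial coefficient with an integer lower index. -/
def intChoose (n : ℕ) (z : ℤ) : ℤ := if z < 0 then 0 else n.choose z.toNat

theorem intChoose_natCast (n k : ℕ) : intChoose n k = n.choose k := by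
  simp [intChoose]

theorem intChoose_of_neg (n : ℕ) {z : ℤ} (h : z < 0) : intChoose n z = 0 := if_pos h

theorem intChoose_succ (n : ℕ) (z : ℤ) :
    intChoose (n + 1) z = intChoose n z + intChoose n (z - 1) := by
  rcases lt_trichotomy z 0 with h | rfl | h
  · simp [intChoose, h, show z - 1 < 0 by omega]
  · simp [intChoose]
  · obtain ⟨k, rfl⟩ : ∃ k : ℕ, z = ((k + 1 : ℕ) : ℤ) := ⟨(z - 1).toNat, by omega⟩
    rw [show ((k + 1 : ℕ) : ℤ) - 1 = (k : ℤ) by push_cast; ring]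
    simp only [intChoose_natCast, Nat.choose_succ_succ]
    push_cast
    ring

/-- The reflected solution of the recursion for the coefficients of powers of `lisSeries`. -/
def reflChoose (m : ℤ) (n : ℕ) (k : ℤ) : ℤ :=
  intChoose n (k - 1) * intChoose n (k - m) - intChoose n k * intChoose n (k - m - 1)

theorem reflChoose_zero_left (n : ℕ) (k : ℤ) : reflChoose 0 n k = 0 := by
  simp [reflChoose]; ring

theorem reflChoose_of_nonpos {m : ℤ} (hm : 0 ≤ m) (n : ℕ) {k : ℤ} (hk : k ≤ 0) :
    reflChoose m n k = 0 := by
  rw [reflChoose, intChoose_of_neg n (show k - 1 < 0 by omega),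
    intChoose_of_neg n (show k - m - 1 < 0 by omega)]
  ring

/-- By Pascal's rule each of the two products satisfies this recursion separately. Their difference
is taken so that it vanishes at `m = 0`, as in the reflection principle for lattice paths. -/
theorem reflChoose_succ (m : ℤ) (n : ℕ) (k : ℤ) :
    reflChoose m (n + 1) k = reflChoose (m - 1) n (k - 1) + reflChoose m n k
      + reflChoose m n (k - 1) + reflChoose (m + 1) n k := by
  simp only [reflChoose, intChoose_succ]
  rw [show k - 1 - (m - 1) = k - m by ring, show k - 1 - m = k - m - 1 by ring,
    show k - (m + 1) = k - m - 1 by ring]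
  ring

theorem coeff_zero_lisSeries_pow (m : ℕ) :
    PowerSeries.coeff 0 (lisSeries ^ (m + 1)) = 0 := by
  simp [lisSeries]

/-- Both sides satisfy the same recursion in `n`. The index `n + 1` excludes the constant term of
the zeroth power, so both vanish at `m = 0`; in degree one only `m = 1`, `k = 1` contributes. -/
theorem coeff_coeff_lisSeries_pow (n : ℕ) : ∀ m k : ℕ,
    (PowerSeries.coeff (n + 1) (lisSeries ^ m)).coeff k = reflChoose m n k := by
  have h0 : ∀ n k : ℕ, (PowerSeries.coeff (n + 1) (lisSeries ^ 0)).coeff k = 0 := by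
    intro n k
    simp [PowerSeries.coeff_one]
  induction n with
  | zero =>
    intro m k
    cases m with
    | zero => rw [h0, Nat.cast_zero, reflChoose_zero_left]
    | succ m =>
      rw [coeff_lisSeries_pow, coeff_zero_lisSeries_pow, coeff_zero_lisSeries_pow (m + 1)]
      have hc : ∀ z : ℤ, intChoose 0 z = if z = 0 then 1 else 0 := by
        intro z
        rcases lt_trichotomy z 0 with h | rfl | h
        · simp [intChoose, h, h.ne]
        · simp [intChoose]
        · obtain ⟨k, rfl⟩ : ∃ k : ℕ, z = ((k + 1 : ℕ) : ℤ) := ⟨(z - 1).toNat, by omega⟩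
          rw [intChoose_natCast]
          simp
          omega
      cases m with
      | zero =>
        simp only [pow_zero, reflChoose, hc]
        rcases k with _ | _ | k
        · simp
        · simp [Polynomial.coeff_X]
        · simp [Polynomial.coeff_X]
          omega
      | succ m =>
        rw [coeff_zero_lisSeries_pow]
        simp only [reflChoose, hc]
        push_cast
        split_ifs <;> first | omega | simp
  | succ n ih =>
    intro m k
    cases m with
    | zero => rw [h0, Nat.cast_zero, reflChoose_zero_left]
    | succ m =>
      rw [coeff_lisSeries_pow, reflChoose_succ]
      simp only [Polynomial.coeff_add]
      have e1 : ((m + 1 : ℕ) : ℤ) - 1 = (m : ℕ) := by push_cast; ring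
      have e2 : ((m + 1 : ℕ) : ℤ) + 1 = (m + 2 : ℕ) := by push_cast; ring
      rw [e1, e2, ih (m + 1), ih (m + 2)]
      cases k with
      | zero =>
        rw [Polynomial.coeff_X_mul_zero, Polynomial.coeff_X_mul_zero,
          reflChoose_of_nonpos (by omega) n (by simp), reflChoose_of_nonpos (by omega) n (by simp),
          reflChoose_of_nonpos (by omega) n (by simp), reflChoose_of_nonpos (by omega) n (by simp)]
      | succ k =>
        have e3 : ((k + 1 : ℕ) : ℤ) - 1 = (k : ℕ) := by push_cast; ring
        rw [Polynomial.coeff_X_mul, Polynomial.coeff_X_mul, ih m, ih (m + 1), e3]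

theorem lisCount_eq_reflChoose (n k : ℕ) : (lisCount (n + 1) k : ℤ) = reflChoose 1 n k := by
  have h := coeff_coeff_lisSeries_pow n 1 k
  rw [pow_one, lisSeries, PowerSeries.coeff_mk, if_neg (Nat.succ_ne_zero n), coeff_lisPoly] at h
  simpa using h

/-- The Narayana numbers, in determinant form. -/
theorem lisCount_succ_succ (n k : ℕ) :
    (lisCount (n + 1) (k + 1) : ℤ) =
      (n.choose k : ℤ) ^ 2 - n.choose (k + 1) * intChoose n ((k : ℤ) - 1) := by
  rw [lisCount_eq_reflChoose, reflChoose, intChoose_natCast]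
  have e : ((k + 1 : ℕ) : ℤ) - 1 = (k : ℕ) := by push_cast; ring
  rw [e, intChoose_natCast]
  ring

/-! ### Comparison with squared binomials, and unimodality. -/

theorem lisCount_le (n k : ℕ) : lisCount (n + 1) (k + 1) ≤ n.choose k ^ 2 := by
  have h := lisCount_succ_succ n k
  have h1 : 0 ≤ intChoose n ((k : ℤ) - 1) := by unfold intChoose; split_ifs <;> positivity
  have h2 : (0 : ℤ) ≤ n.choose (k + 1) * intChoose n ((k : ℤ) - 1) := by positivity
  have h3 : (lisCount (n + 1) (k + 1) : ℤ) ≤ (n.choose k : ℤ) ^ 2 := by linarith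
  exact_mod_cast h3

/-- The count equals C(n,k)²(n+1)/((k+1)(n−k+1)), whose denominator is at most (n+1)². -/
theorem choose_sq_le_mul_lisCount {n k : ℕ} (hk : k ≤ n) :
    n.choose k ^ 2 ≤ (n + 1) * lisCount (n + 1) (k + 1) := by
  have h := lisCount_succ_succ n k
  suffices (n.choose k : ℤ) ^ 2 ≤ (n + 1) * (lisCount (n + 1) (k + 1) : ℤ) by exact_mod_cast this
  rw [h]
  cases k with
  | zero =>
    rw [intChoose_of_neg n (by simp)]
    simp
  | succ k =>
    have e : ((k + 1 : ℕ) : ℤ) - 1 = (k : ℕ) := by push_cast; ring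
    rw [e, intChoose_natCast]
    obtain ⟨l, rfl⟩ := Nat.exists_eq_add_of_le hk
    have h1 := Nat.choose_succ_right_eq (k + 1 + l) (k + 1)
    have h2 := Nat.choose_succ_right_eq (k + 1 + l) k
    rw [show k + 1 + l - (k + 1) = l by omega] at h1
    rw [show k + 1 + l - k = l + 1 by omega] at h2
    zify at h1 h2
    set a : ℤ := ((k + 1 + l).choose k : ℤ)
    set b : ℤ := ((k + 1 + l).choose (k + 1) : ℤ)
    set c : ℤ := ((k + 1 + l).choose (k + 1 + 1) : ℤ)
    -- Multiply the consecutive ratios c/b = l/(k+2) and a/b = (k+1)/(l+1).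
    have hprod : (c * a) * ((k + 2) * (l + 1)) = b ^ 2 * (l * (k + 1)) := by
      linear_combination a * (l + 1) * h1 - b * l * h2
    have hpos : (0 : ℤ) < (k + 2) * (l + 1) := by positivity
    push_cast
    refine le_of_mul_le_mul_right ?_ hpos
    have e2 : ((k : ℤ) + 1 + l + 1) * (b ^ 2 - c * a) * ((k + 2) * (l + 1))
        = (k + 1 + l + 1) * (b ^ 2 * (k + l + 2)) := by
      linear_combination (-(k + 1 + l + 1 : ℤ)) * hprod
    rw [e2]
    have e3 : ((k : ℤ) + 1 + l + 1) * (b ^ 2 * (k + l + 2)) - b ^ 2 * ((k + 2) * (l + 1))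
        = b ^ 2 * (k ^ 2 + k * l + 3 * k + l ^ 2 + 2 * l + 2) := by ring
    have : 0 ≤ b ^ 2 * ((k : ℤ) ^ 2 + k * l + 3 * k + l ^ 2 + 2 * l + 2) := by positivity
    linarith

/-- The binomials already stop growing from `k` on once `n ≤ 2 * k + 1`; this one unit of slack
absorbs the shift from length to binomial index later. -/
theorem choose_le_choose_of_le_of_half_le {n k l : ℕ} (hk : n ≤ 2 * k + 1) (hkl : k ≤ l) :
    n.choose l ≤ n.choose k := by
  induction l, hkl using Nat.le_induction with
  | base => rfl
  | succ l hl ih =>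
    refine le_trans ?_ ih
    have h := Nat.choose_succ_right_eq n l
    refine Nat.le_of_mul_le_mul_right (h.le.trans ?_) (Nat.succ_pos l)
    exact Nat.mul_le_mul_left _ (by omega)

theorem choose_le_choose_of_le_of_le_half {n k l : ℕ} (hk : 2 * k ≤ n + 1) (hlk : l ≤ k) :
    n.choose l ≤ n.choose k := by
  induction k, hlk using Nat.le_induction with
  | base => rfl
  | succ k hl ih =>
    refine (ih (by omega)).trans ?_
    have h := Nat.choose_succ_right_eq n k
    refine Nat.le_of_mul_le_mul_right (le_trans ?_ h.ge) (Nat.succ_pos k)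
    exact Nat.mul_le_mul_left _ (by omega)

/-! ### Stirling bounds and entropy asymptotics. -/

theorem mul_log_sub_le_log_factorial (m : ℕ) :
    (m : ℝ) * Real.log m - m ≤ Real.log (m.factorial : ℝ) := by
  induction m with
  | zero => simp
  | succ m ih =>
    rw [Nat.factorial_succ, Nat.cast_mul, Real.log_mul (by positivity) (by positivity)]
    rcases Nat.eq_zero_or_pos m with rfl | hm
    · simp
    have hm' : (0 : ℝ) < m := by exact_mod_cast hm
    have h := Real.log_le_sub_one_of_pos (show (0 : ℝ) < (m + 1) / m by positivity)
    rw [Real.log_div (by positivity) (by positivity)] at h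
    have h2 : (m : ℝ) * (Real.log (m + 1) - Real.log m) ≤ 1 := by
      calc _ ≤ (m : ℝ) * ((m + 1) / m - 1) := by gcongr
        _ = 1 := by field_simp; ring
    push_cast
    nlinarith

theorem log_factorial_le (m : ℕ) :
    Real.log (m.factorial : ℝ) ≤ (m : ℝ) * Real.log m - m + (1 + Real.log (m + 1)) := by
  have key : ∀ m : ℕ, Real.log ((m + 1).factorial : ℝ) ≤
      ((m : ℝ) + 1) * Real.log (m + 1) - (m + 1) + (1 + Real.log (m + 1)) := by
    intro m
    induction m with
    | zero => simp
    | succ m ih =>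
      rw [Nat.factorial_succ, Nat.cast_mul, Real.log_mul (by positivity) (by positivity)]
      have h := Real.log_le_sub_one_of_pos (show (0 : ℝ) < (m + 1) / (m + 1 + 1) by positivity)
      rw [Real.log_div (by positivity) (by positivity)] at h
      have h2 : ((m : ℝ) + 1 + 1) * (Real.log (m + 1) - Real.log (m + 1 + 1)) ≤ -1 := by
        calc _ ≤ ((m : ℝ) + 1 + 1) * ((m + 1) / (m + 1 + 1) - 1) := by gcongr
          _ = -1 := by field_simp; ring
      push_cast
      nlinarith
  cases m with
  | zero => simp
  | succ m =>
    refine (key m).trans ?_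
    push_cast
    have : Real.log ((m : ℝ) + 1) ≤ Real.log (m + 1 + 1) :=
      Real.log_le_log (by positivity) (by linarith)
    linarith

/-- In log n! − log k! − log l! the linear Stirling terms cancel and the main terms form the
entropy. The factorial bounds err on one side only, so the worst case is the two in the denominator,
whence the factor 2. -/
theorem abs_log_choose_sub_le {n k : ℕ} (hk : k ≤ n) :
    |Real.log (n.choose k : ℝ) - n * Real.binEntropy (k / n)| ≤ 2 * (1 + Real.log (n + 1)) := by
  obtain ⟨l, rfl⟩ := Nat.exists_eq_add_of_le hk
  have hch : Real.log ((k + l).factorial : ℝ) = Real.log ((k + l).choose k : ℝ)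
      + Real.log (k.factorial : ℝ) + Real.log (l.factorial : ℝ) := by
    have h := Nat.choose_mul_factorial_mul_factorial hk
    rw [Nat.add_sub_cancel_left] at h
    have hc : ((k + l).choose k : ℝ) ≠ 0 := by
      exact_mod_cast (Nat.choose_pos hk).ne'
    rw [← h, Nat.cast_mul, Nat.cast_mul, Real.log_mul (by positivity) (by positivity),
      Real.log_mul hc (by positivity)]
  have hent : ((k + l : ℕ) : ℝ) * Real.binEntropy (k / (k + l : ℕ)) =
      (k + l) * Real.log (k + l) - k * Real.log k - l * Real.log l := by
    rcases Nat.eq_zero_or_pos k with rfl | hk0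
    · simp
    rcases Nat.eq_zero_or_pos l with rfl | hl0
    · have : (k : ℝ) ≠ 0 := by positivity
      simp [this]
    have hk' : (0 : ℝ) < k := by exact_mod_cast hk0
    have hl' : (0 : ℝ) < l := by exact_mod_cast hl0
    have e : 1 - (k : ℝ) / (k + l) = l / (k + l) := by field_simp; ring
    push_cast
    rw [Real.binEntropy, e, Real.log_inv, Real.log_inv, Real.log_div (by positivity) (by positivity),
      Real.log_div (by positivity) (by positivity)]
    field_simp
    ring
  have a1 := mul_log_sub_le_log_factorial (k + l)
  have a2 := mul_log_sub_le_log_factorial k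
  have a3 := mul_log_sub_le_log_factorial l
  have b1 := log_factorial_le (k + l)
  have b2 := log_factorial_le k
  have b3 := log_factorial_le l
  have c2 : Real.log ((k : ℝ) + 1) ≤ Real.log (k + l + 1) :=
    Real.log_le_log (by positivity) (by linarith [(Nat.cast_nonneg l : (0 : ℝ) ≤ l)])
  have c3 : Real.log ((l : ℝ) + 1) ≤ Real.log (k + l + 1) :=
    Real.log_le_log (by positivity) (by linarith [(Nat.cast_nonneg k : (0 : ℝ) ≤ k)])
  have c4 : 0 ≤ Real.log ((l : ℝ) + 1) :=
    Real.log_nonneg (by linarith [(Nat.cast_nonneg l : (0 : ℝ) ≤ l)])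
  rw [hent, abs_le]
  push_cast at *
  constructor <;> linarith

theorem tendsto_log_natCast_div : Tendsto (fun n : ℕ => Real.log n / n) atTop (𝓝 0) := by
  have h := Real.isLittleO_log_id_atTop.tendsto_div_nhds_zero
  exact h.comp tendsto_natCast_atTop_atTop

theorem tendsto_log_choose_div {k : ℕ → ℕ} {x : ℝ} (hk : ∀ᶠ n in atTop, k n ≤ n - 1)
    (hx : Tendsto (fun n : ℕ => (k n : ℝ) / n) atTop (𝓝 x)) :
    Tendsto (fun n : ℕ => 1 / (n : ℝ) * Real.log ((n - 1).choose (k n) : ℝ)) atTop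
      (𝓝 (Real.binEntropy x)) := by
  have h1 : Tendsto (fun n : ℕ => ((n - 1 : ℕ) : ℝ) / n) atTop (𝓝 1) := by
    have : Tendsto (fun n : ℕ => 1 - 1 / (n : ℝ)) atTop (𝓝 (1 - 0)) :=
      tendsto_const_nhds.sub tendsto_one_div_atTop_nhds_zero_nat
    rw [sub_zero] at this
    refine this.congr' ?_
    filter_upwards [eventually_ge_atTop 1] with n hn
    have hn' : (n : ℝ) ≠ 0 := by positivity
    rw [Nat.cast_sub hn]
    field_simp
    simp
  have h2 : Tendsto (fun n : ℕ => ((n - 1 : ℕ) : ℝ) / n *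
      Real.binEntropy ((k n / n) / (((n - 1 : ℕ) : ℝ) / n))) atTop (𝓝 (Real.binEntropy x)) := by
    have := h1.mul ((Real.binEntropy_continuous.tendsto _).comp (hx.div h1 one_ne_zero))
    simpa using this
  have h3 : Tendsto (fun n : ℕ => 2 * (1 / (n : ℝ) + Real.log n / n)) atTop (𝓝 0) := by
    simpa using (tendsto_one_div_atTop_nhds_zero_nat.add tendsto_log_natCast_div).const_mul
      (2 : ℝ)
  have h4 : Tendsto (fun n : ℕ => 1 / (n : ℝ) * Real.log ((n - 1).choose (k n) : ℝ) -
      ((n - 1 : ℕ) : ℝ) / n * Real.binEntropy ((k n / n) / (((n - 1 : ℕ) : ℝ) / n))) atTop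
      (𝓝 0) := by
    refine squeeze_zero_norm' ?_ h3
    filter_upwards [hk, eventually_ge_atTop 1] with n hn hn1
    have hn' : (0 : ℝ) < n := by exact_mod_cast hn1
    have h := abs_log_choose_sub_le hn
    rw [div_div_div_cancel_right₀ hn'.ne', Real.norm_eq_abs]
    have e : 1 / (n : ℝ) * Real.log ((n - 1).choose (k n) : ℝ) -
        ((n - 1 : ℕ) : ℝ) / n * Real.binEntropy (k n / ((n - 1 : ℕ) : ℝ)) = 1 / (n : ℝ) *
        (Real.log ((n - 1).choose (k n) : ℝ)
          - ((n - 1 : ℕ) : ℝ) * Real.binEntropy (k n / ((n - 1 : ℕ) : ℝ))) := by ring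
    rw [e, abs_mul, abs_of_pos (by positivity : 0 < 1 / (n : ℝ))]
    have e2 : (((n - 1 : ℕ) : ℝ) + 1) = n := by exact_mod_cast Nat.sub_add_cancel hn1
    rw [e2] at h
    calc _ ≤ 1 / (n : ℝ) * (2 * (1 + Real.log n)) := by gcongr
      _ = _ := by ring
  simpa using h4.add h2

/-! ### Exponential rates of counts and probabilities. -/

/-- The number of 231-avoiding permutations of `n` letters whose longest increasing subsequence
has length in `S`. -/
noncomputable def lisCountIn (n : ℕ) (S : Set ℕ) : ℕ := by
  classical exact ((avoiders231 n).filter fun σ => longestIncreasing σ ∈ S).card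

theorem choose_sq_le_mul_lisCountIn {n k : ℕ} {S : Set ℕ} (hk : k ≤ n) (hS : k + 1 ∈ S) :
    n.choose k ^ 2 ≤ (n + 1) * lisCountIn (n + 1) S := by
  classical
  refine (choose_sq_le_mul_lisCount hk).trans (Nat.mul_le_mul_left _ (Finset.card_le_card ?_))
  intro σ hσ
  simp only [Finset.mem_filter] at hσ ⊢
  exact ⟨hσ.1, hσ.2 ▸ hS⟩

theorem lisCountIn_le {n k : ℕ} {S : Set ℕ}
    (h : ∀ l ≤ n, l + 1 ∈ S → n.choose l ≤ n.choose k) :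
    lisCountIn (n + 1) S ≤ (n + 1) * n.choose k ^ 2 := by
  classical
  have hmaps : ∀ σ ∈ (avoiders231 (n + 1)).filter fun σ => longestIncreasing σ ∈ S,
      longestIncreasing σ - 1 ∈ Finset.range (n + 1) := by
    intro σ _
    have := longestIncreasing_le_self σ
    simp only [Finset.mem_range]
    omega
  unfold lisCountIn
  rw [Finset.card_eq_sum_card_fiberwise hmaps]
  calc _ ≤ ∑ l ∈ Finset.range (n + 1), n.choose k ^ 2 := Finset.sum_le_sum fun l hl => ?_
    _ = _ := by simp
  by_cases hlS : l + 1 ∈ S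
  · refine le_trans ?_ ((lisCount_le n l).trans
      (Nat.pow_le_pow_left (h l (by simpa [Nat.lt_succ_iff] using hl) hlS) 2))
    refine Finset.card_le_card fun σ hσ => ?_
    simp only [Finset.mem_filter] at hσ ⊢
    have := one_le_longestIncreasing σ
    exact ⟨hσ.1.1, by omega⟩
  · rw [Finset.card_eq_zero.2]
    · exact Nat.zero_le _
    · refine Finset.eq_empty_of_forall_notMem fun σ hσ => hlS ?_
      simp only [Finset.mem_filter] at hσ
      have := one_le_longestIncreasing σ
      rw [← hσ.2, Nat.sub_add_cancel this]
      exact hσ.1.2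

/-- Laplace's principle: the count lies between C(n−1,k)²/n and n·C(n−1,k)², where `k n + 1` is the
dominant length, and the factors of n vanish at exponential scale. -/
theorem tendsto_log_lisCountIn_div {S : ℕ → Set ℕ} {k : ℕ → ℕ} {x : ℝ}
    (hk : ∀ᶠ n in atTop, k n ≤ n - 1) (hS : ∀ᶠ n in atTop, k n + 1 ∈ S n)
    (hmax : ∀ᶠ n in atTop, ∀ l, l + 1 ∈ S n → (n - 1).choose l ≤ (n - 1).choose (k n))
    (hx : Tendsto (fun n : ℕ => (k n : ℝ) / n) atTop (𝓝 x)) :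
    (∀ᶠ n in atTop, 0 < lisCountIn n (S n)) ∧
      Tendsto (fun n : ℕ => 1 / (n : ℝ) * Real.log (lisCountIn n (S n) : ℝ)) atTop
        (𝓝 (2 * Real.binEntropy x)) := by
  have hlow : ∀ᶠ n in atTop, (n - 1).choose (k n) ^ 2 ≤ n * lisCountIn n (S n) := by
    filter_upwards [hk, hS, eventually_ge_atTop 1] with n h1 h2 hn
    have := choose_sq_le_mul_lisCountIn h1 h2
    rwa [Nat.sub_add_cancel hn] at this
  have hup : ∀ᶠ n in atTop, lisCountIn n (S n) ≤ n * (n - 1).choose (k n) ^ 2 := by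
    filter_upwards [hmax, eventually_ge_atTop 1] with n h2 hn
    have := lisCountIn_le (n := n - 1) (k := k n) (S := S n) fun l _ hl => h2 l hl
    rwa [Nat.sub_add_cancel hn] at this
  have hpos : ∀ᶠ n in atTop, 0 < lisCountIn n (S n) := by
    filter_upwards [hlow, hk] with n h1 h2
    have := Nat.choose_pos h2
    exact Nat.pos_of_mul_pos_left (lt_of_lt_of_le (by positivity) h1)
  refine ⟨hpos, ?_⟩
  have hc := (tendsto_log_choose_div hk hx).const_mul 2
  have hd : Tendsto (fun n : ℕ => 1 / (n : ℝ) * Real.log (lisCountIn n (S n) : ℝ)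
      - 2 * (1 / (n : ℝ) * Real.log ((n - 1).choose (k n) : ℝ))) atTop (𝓝 0) := by
    refine squeeze_zero_norm' ?_ tendsto_log_natCast_div
    filter_upwards [hlow, hup, hpos, hk, eventually_ge_atTop 1] with n h1 h2 h3 h4 hn
    have hn' : (0 : ℝ) < n := by exact_mod_cast hn
    have h3' : (0 : ℝ) < lisCountIn n (S n) := by exact_mod_cast h3
    have hcp : (0 : ℝ) < ((n - 1).choose (k n) : ℝ) := by exact_mod_cast Nat.choose_pos h4
    have h1' : (((n - 1).choose (k n) : ℝ)) ^ 2 ≤ n * lisCountIn n (S n) := by exact_mod_cast h1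
    have h2' : (lisCountIn n (S n) : ℝ) ≤ n * ((n - 1).choose (k n) : ℝ) ^ 2 := by
      exact_mod_cast h2
    have g1 := Real.log_le_log (by positivity) h1'
    have g2 := Real.log_le_log h3' h2'
    rw [Real.log_mul hn'.ne' h3'.ne', Real.log_pow] at g1
    rw [Real.log_mul hn'.ne' (by positivity), Real.log_pow] at g2
    push_cast at g1 g2
    have e : 1 / (n : ℝ) * Real.log (lisCountIn n (S n) : ℝ)
        - 2 * (1 / (n : ℝ) * Real.log ((n - 1).choose (k n) : ℝ)) =
        (Real.log (lisCountIn n (S n) : ℝ) - 2 * Real.log ((n - 1).choose (k n) : ℝ)) / n := by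
      ring
    rw [e, Real.norm_eq_abs, abs_div, abs_of_pos hn']
    gcongr
    rw [abs_le]
    constructor <;> linarith
  simpa using hd.add hc

theorem avoidMeasure_perm231_real (n : ℕ) (S : Set ℕ) :
    (avoidMeasure perm231 n).real {σ | longestIncreasing σ ∈ S} =
      (lisCountIn n S : ℝ) / lisCountIn n Set.univ := by
  classical
  have h1 : avoiding perm231 n = (avoiders231 n : Set (Equiv.Perm (Fin n))) := by
    ext σ
    simp [avoiding, mem_avoiders231]
  have h2 : {σ : Equiv.Perm (Fin n) | longestIncreasing σ ∈ S} =
      ((Finset.univ.filter fun σ => longestIncreasing σ ∈ S : Finset (Equiv.Perm (Fin n))) :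
        Set (Equiv.Perm (Fin n))) := by
    ext σ
    simp
  rw [Measure.real, avoidMeasure, h1, h2, uniformOn_apply_finset, ENNReal.toReal_div]
  simp only [ENNReal.toReal_natCast, lisCountIn, Set.mem_univ, Finset.filter_true]
  rw [Finset.inter_filter, Finset.inter_univ]

theorem avoidMeasure_perm312_real (n : ℕ) (S : Set ℕ) :
    (avoidMeasure perm312 n).real {σ | longestIncreasing σ ∈ S} =
      (lisCountIn n S : ℝ) / lisCountIn n Set.univ := by
  classical
  have h1 : avoiding perm312 n = ((avoiders231 n).image (·⁻¹) : Finset (Equiv.Perm (Fin n))) := by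
    ext σ
    simp only [avoiding, Set.mem_ofPred_eq, contains_perm312_iff_inv, Finset.coe_image,
      Set.mem_image, Finset.mem_coe, mem_avoiders231]
    exact ⟨fun h => ⟨σ⁻¹, h, inv_inv σ⟩, by rintro ⟨τ, h, rfl⟩; rwa [inv_inv]⟩
  have h2 : {σ : Equiv.Perm (Fin n) | longestIncreasing σ ∈ S} =
      ((Finset.univ.filter fun σ => longestIncreasing σ ∈ S : Finset (Equiv.Perm (Fin n))) :
        Set (Equiv.Perm (Fin n))) := by
    ext σ
    simp
  have h3 : (avoiders231 n).image (·⁻¹) ∩ (Finset.univ.filter fun σ => longestIncreasing σ ∈ S) =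
      ((avoiders231 n).filter fun σ => longestIncreasing σ ∈ S).image (·⁻¹) := by
    rw [Finset.inter_filter, Finset.inter_univ, Finset.filter_image]
    simp only [longestIncreasing_inv]
  rw [Measure.real, avoidMeasure, h1, h2, uniformOn_apply_finset, ENNReal.toReal_div, h3,
    Finset.card_image_of_injective _ inv_injective, Finset.card_image_of_injective _ inv_injective]
  simp only [ENNReal.toReal_natCast, lisCountIn, Set.mem_univ, Finset.filter_true]

/-- The normalising constant: with all lengths allowed the central binomial dominates, giving the
growth 4ⁿ of the Catalan numbers. -/
theorem tendsto_log_lisCountIn_univ_div :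
    (∀ᶠ n in atTop, 0 < lisCountIn n Set.univ) ∧
      Tendsto (fun n : ℕ => 1 / (n : ℝ) * Real.log (lisCountIn n Set.univ : ℝ)) atTop
        (𝓝 (2 * Real.log 2)) := by
  rw [← Real.binEntropy_two_inv]
  refine tendsto_log_lisCountIn_div (S := fun _ => Set.univ) (k := fun n => (n - 1) / 2)
    (.of_forall fun n => Nat.div_le_self _ _) (.of_forall fun n => trivial)
    (.of_forall fun n l _ => Nat.choose_le_middle l (n - 1)) ?_
  have h : Tendsto (fun n : ℕ => (1 : ℝ) / n) atTop (𝓝 0) := tendsto_one_div_atTop_nhds_zero_nat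
  refine tendsto_of_tendsto_of_tendsto_of_le_of_le' (g := fun n : ℕ => (2⁻¹ : ℝ) - 1 / n)
    (h := fun n : ℕ => (2⁻¹ : ℝ)) (by simpa using h.const_sub (2⁻¹ : ℝ)) tendsto_const_nhds ?_ ?_
  · filter_upwards [eventually_ge_atTop 1] with n hn
    have hn' : (0 : ℝ) < n := by exact_mod_cast hn
    have h1 : (n : ℝ) ≤ 2 * ((n - 1) / 2 : ℕ) + 2 := by
      have : n ≤ 2 * ((n - 1) / 2) + 2 := by omega
      exact_mod_cast this
    rw [le_div_iff₀ hn', sub_mul, one_div_mul_cancel hn'.ne']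
    linarith
  · filter_upwards [eventually_ge_atTop 1] with n hn
    have hn' : (0 : ℝ) < n := by exact_mod_cast hn
    have h1 : 2 * (((n - 1) / 2 : ℕ) : ℝ) ≤ n := by
      have : 2 * ((n - 1) / 2) ≤ n := by omega
      exact_mod_cast this
    rw [div_le_iff₀ hn']
    linarith

/-- The rate is twice the entropy deficit; since H(1) = 0, the separately defined value at 1 fits
the same formula. -/
theorem neg_rateInc_eq (x : ℝ) :
    -rateInc x = 2 * Real.binEntropy x - 2 * Real.log 2 := by
  unfold rateInc
  split_ifs with h
  · rw [h, show (4 : ℝ) = 2 ^ 2 by norm_num, Real.log_pow]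
    simp
  · rw [Real.binEntropy, Real.log_inv, Real.log_inv]
    ring

theorem tendsto_log_avoidMeasure {η : Equiv.Perm (Fin 3)} (hη : η = perm231 ∨ η = perm312)
    {S : ℕ → Set ℕ} {k : ℕ → ℕ} {x : ℝ}
    (hk : ∀ᶠ n in atTop, k n ≤ n - 1) (hS : ∀ᶠ n in atTop, k n + 1 ∈ S n)
    (hmax : ∀ᶠ n in atTop, ∀ l, l + 1 ∈ S n → (n - 1).choose l ≤ (n - 1).choose (k n))
    (hx : Tendsto (fun n : ℕ => (k n : ℝ) / n) atTop (𝓝 x)) :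
    (∀ᶠ n in atTop, 0 < (avoidMeasure η n).real {σ | longestIncreasing σ ∈ S n}) ∧
      Tendsto (fun n : ℕ => 1 / (n : ℝ) *
        Real.log ((avoidMeasure η n).real {σ | longestIncreasing σ ∈ S n})) atTop
        (𝓝 (-rateInc x)) := by
  have hreal : ∀ n, (avoidMeasure η n).real {σ | longestIncreasing σ ∈ S n} =
      (lisCountIn n (S n) : ℝ) / lisCountIn n Set.univ := by
    intro n
    rcases hη with rfl | rfl
    · exact avoidMeasure_perm231_real n (S n)
    · exact avoidMeasure_perm312_real n (S n)
  obtain ⟨hp, ht⟩ := tendsto_log_lisCountIn_div hk hS hmax hx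
  obtain ⟨hp1, ht1⟩ := tendsto_log_lisCountIn_univ_div
  simp only [hreal]
  constructor
  · filter_upwards [hp, hp1] with n h h1
    positivity
  · rw [neg_rateInc_eq]
    refine (ht.sub ht1).congr' ?_
    filter_upwards [hp, hp1] with n h h1
    rw [Real.log_div (by positivity) (by positivity)]
    ring

theorem tendsto_natCast_pred_div {k : ℕ → ℕ} {x : ℝ} (hk : ∀ᶠ n in atTop, 1 ≤ k n)
    (hx : Tendsto (fun n : ℕ => (k n : ℝ) / n) atTop (𝓝 x)) :
    Tendsto (fun n : ℕ => ((k n - 1 : ℕ) : ℝ) / n) atTop (𝓝 x) := by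
  have h := hx.sub tendsto_one_div_atTop_nhds_zero_nat
  rw [sub_zero] at h
  refine h.congr' ?_
  filter_upwards [hk] with n hn
  rw [Nat.cast_sub hn, sub_div, Nat.cast_one]

end PatternAvoidance

/-! ### The two tails. -/

theorem theorem1p2 (η : Equiv.Perm (Fin 3))
    (hη : η = PatternAvoidance.perm231 ∨ η = PatternAvoidance.perm312) :
    (∀ x ∈ Set.Icc (1 / 2 : ℝ) 1,
      (∀ᶠ n : ℕ in atTop, 0 < (PatternAvoidance.avoidMeasure η n).real
        {σ | (n : ℝ) * x ≤ (PatternAvoidance.longestIncreasing σ : ℝ)}) ∧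
      Tendsto (fun n : ℕ => 1 / (n : ℝ) * Real.log ((PatternAvoidance.avoidMeasure η n).real
        {σ | (n : ℝ) * x ≤ (PatternAvoidance.longestIncreasing σ : ℝ)}))
        atTop (𝓝 (-PatternAvoidance.rateInc x))) ∧
    (∀ x ∈ Set.Ioc (0 : ℝ) (1 / 2),
      (∀ᶠ n : ℕ in atTop, 0 < (PatternAvoidance.avoidMeasure η n).real
        {σ | (PatternAvoidance.longestIncreasing σ : ℝ) ≤ (n : ℝ) * x}) ∧
      Tendsto (fun n : ℕ => 1 / (n : ℝ) * Real.log ((PatternAvoidance.avoidMeasure η n).real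
        {σ | (PatternAvoidance.longestIncreasing σ : ℝ) ≤ (n : ℝ) * x}))
        atTop (𝓝 (-PatternAvoidance.rateInc x))) := by
  constructor
  · rintro x ⟨hx0, hx1⟩
    have hpos : ∀ᶠ n : ℕ in atTop, 1 ≤ ⌈x * n⌉₊ := by
      filter_upwards [eventually_ge_atTop 1] with n hn
      have hn' : (0 : ℝ) < n := by exact_mod_cast hn
      exact Nat.ceil_pos.2 (by positivity)
    -- The ceiling is the least admissible length, hence dominant since `x ≥ 1/2`; subtracting 1
    -- turns a length into a binomial index.
    refine PatternAvoidance.tendsto_log_avoidMeasure hη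
      (S := fun n => {m : ℕ | (n : ℝ) * x ≤ (m : ℝ)}) (k := fun n => ⌈x * n⌉₊ - 1) ?_ ?_ ?_
      (PatternAvoidance.tendsto_natCast_pred_div hpos
        ((tendsto_nat_ceil_mul_div_atTop (by linarith)).comp tendsto_natCast_atTop_atTop))
    · refine .of_forall fun n => Nat.sub_le_sub_right (Nat.ceil_le.2 ?_) 1
      exact mul_le_of_le_one_left (Nat.cast_nonneg n) hx1
    · filter_upwards [hpos] with n hn
      rw [Nat.sub_add_cancel hn, mul_comm]
      exact Nat.le_ceil _
    · refine .of_forall fun n l hl => ?_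
      have h1 : ⌈x * n⌉₊ ≤ l + 1 := Nat.ceil_le.2 (by rw [mul_comm]; exact hl)
      have h2 : (n : ℝ) ≤ 2 * (⌈x * n⌉₊ : ℝ) := by
        have := Nat.le_ceil (x * n)
        nlinarith [(Nat.cast_nonneg n : (0 : ℝ) ≤ n)]
      have h3 : n ≤ 2 * ⌈x * n⌉₊ := by exact_mod_cast h2
      exact PatternAvoidance.choose_le_choose_of_le_of_half_le (by omega) (by omega)
  · rintro x ⟨hx0, hx1⟩
    have hpos : ∀ᶠ n : ℕ in atTop, 1 ≤ ⌊x * n⌋₊ := by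
      -- Some length is admissible only once `x * n ≥ 1`, which needs `x > 0`.
      have h := (tendsto_natCast_atTop_atTop (R := ℝ)).const_mul_atTop hx0
      filter_upwards [h.eventually_ge_atTop 1] with n hn
      exact Nat.le_floor (by simpa using hn)
    have hle : ∀ n : ℕ, (⌊x * n⌋₊ : ℝ) ≤ x * n := fun n => Nat.floor_le (by positivity)
    have hhalf : ∀ n : ℕ, 2 * ⌊x * n⌋₊ ≤ n := by
      intro n
      have h2 : 2 * (⌊x * n⌋₊ : ℝ) ≤ n := by
        nlinarith [hle n, (Nat.cast_nonneg n : (0 : ℝ) ≤ n)]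
      exact_mod_cast h2
    -- Here the greatest admissible length, the floor, dominates since `x ≤ 1/2`.
    refine PatternAvoidance.tendsto_log_avoidMeasure hη
      (S := fun n => {m : ℕ | (m : ℝ) ≤ (n : ℝ) * x}) (k := fun n => ⌊x * n⌋₊ - 1) ?_ ?_ ?_
      (PatternAvoidance.tendsto_natCast_pred_div hpos
        ((tendsto_nat_floor_mul_div_atTop hx0.le).comp tendsto_natCast_atTop_atTop))
    · refine .of_forall fun n => ?_
      have := hhalf n
      omega
    · filter_upwards [hpos] with n hn
      rw [Nat.sub_add_cancel hn]
      exact (hle n).trans_eq (mul_comm _ _)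
    · refine .of_forall fun n l hl => ?_
      have h1 : l + 1 ≤ ⌊x * n⌋₊ := Nat.le_floor (by rw [mul_comm]; exact hl)
      have := hhalf n
      exact PatternAvoidance.choose_le_choose_of_le_of_le_half (by omega) (by omega)
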